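/- A topological group $G$ has the \emph{closed range property} if for every Hausdorff topological group $H$ and every continuous homomorphism $\varphi : G \to H$, the image $\varphi(G)$ is closed in $H$. Let $d$ be a natural number, let $T$ be a $d$-regular tree, and let $l : E(T) \to \{1,\dots,d\}$ be a legal labelling, that is, for every vertex $v$ the restriction $l_v$ of $l$ to the set $E(v)$ of edges incident to $v$ is a bijection onto $\{1,\dots,d\}$. Equip $\mathrm{Aut}(T)$ with the permutation topology, a base of which is formed by the sets $\{g \in \mathrm{Aut}(T) : g(x) = g_0(x) \text{ for all } x \in \mathcal F\}$ with $g_0 \in \mathrm{Aut}(T)$ and $\mathcal F$ a finite set of vertices, and equip subgroups with the induced topology. For $g \in \mathrm{Aut}(T)$ and a vertex $v$ let $\sigma(g,v) := l_{g(v)} \circ g \circ l_v^{-1} \in \mathrm{Sym}(d)$ be the local action of $g$ at $v$. For a subgroup $F \le \mathrm{Sym}(d)$ let $$U_1(F) := \{ g \in \mathrm{Aut}(T) : \sigma(g,v) \in F \text{ for every vertex } v \}$$ be the Burger--Mozes universal group. For $G \le \mathrm{Aut}(T)$ let $G^{+_1}$ be the subgroup generated by the elements of $G$ that fix both endpoints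 of some edge of $T$; equivalently, by the fixators in $G$ of the sets $B(v,1) \cap B(w,1) = \{v,w\}$, where $\{v,w\}$ runs through the edges of $T$ and $B(v,1)$ is the closed ball of radius $1$ about $v$. Then, for every $F \le \mathrm{Sym}(d)$, the group $U_1(F)^{+_1}$ has the closed range property. If, in addition, $F$ is transitive on $\{1,\dots,d\}$ and generated by its point stabilisers, then $U_1(F)$ has the closed range property. -/

import Mathlib

namespace TreeGroups

section Topology

variable {V : Type*} (T : SimpleGraph V)

/-- The permutation topology on the automorphism group of a graph: the topology of pointwise
convergence on the discrete vertex set. -/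
instance autTopology : TopologicalSpace (T ≃g T) :=
  TopologicalSpace.induced (fun g : T ≃g T => (g : V → V))
    (@Pi.topologicalSpace V (fun _ => V) (fun _ => ⊥))

/-- The sets of all automorphisms that agree with a given one on a given finite set of vertices
form a base of the permutation topology. -/
theorem autTopology_isTopologicalBasis :
    TopologicalSpace.IsTopologicalBasis
      {U : Set (T ≃g T) | ∃ (g₀ : T ≃g T) (S : Finset V), U = {g | ∀ x ∈ S, g x = g₀ x}} := by
  letI : TopologicalSpace V := ⊥
  haveI : DiscreteTopology V := ⟨rfl⟩
  refine TopologicalSpace.isTopologicalBasis_of_isOpen_of_nhds ?_ ?_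
  · rintro U ⟨g₀, S, rfl⟩
    refine ⟨{f : V → V | ∀ x ∈ S, f x = g₀ x}, ?_, rfl⟩
    have h : {f : V → V | ∀ x ∈ S, f x = g₀ x}
        = (S : Set V).pi (fun x => {g₀ x}) := by
      ext f; simp [Set.mem_pi]
    rw [h]
    exact isOpen_set_pi S.finite_toSet (fun _ _ => isOpen_discrete _)
  · rintro g U hg ⟨W, hW, rfl⟩
    obtain ⟨S, u, hu, hS⟩ := isOpen_pi_iff.1 hW _ hg
    refine ⟨{f | ∀ x ∈ S, f x = g x}, ⟨g, S, rfl⟩, fun _ _ => rfl, fun f hf => hS ?_⟩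
    intro x hx
    have h1 : f x = g x := hf x hx
    change f x ∈ u x
    rw [h1]
    exact (hu x hx).2

end Topology

/-- The closed range property: every continuous homomorphism to a (Hausdorff) topological group
has closed range. -/
def HasClosedRangeProperty.{w, u} (G : Type u) [Group G] [TopologicalSpace G] : Prop :=
  ∀ (H : Type w) [Group H] [TopologicalSpace H] [IsTopologicalGroup H] [T2Space H]
    (φ : G →* H), Continuous φ → IsClosed (Set.range φ)

section Tree

variable {V : Type*} {T : SimpleGraph V}

/-- The closed ball `B(v, n)`. -/
def closedBall (T : SimpleGraph V) (v : V) (n : ℕ) : Set V :=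
  {u | T.edist v u ≤ n}

/-- The group `G^{+_k}`, generated by the fixators in `G` of the sets `B(v, k) ∩ B(w, k)`,
where `{v, w}` runs through the edges. -/
def plusGroup (G : Subgroup (T ≃g T)) (k : ℕ) : Subgroup (T ≃g T) :=
  Subgroup.closure
    {g | g ∈ G ∧ ∃ v w : V, T.Adj v w ∧ ∀ x ∈ closedBall T v k ∩ closedBall T w k, g x = x}

/-- A legal labelling of the edges of `T` by the colours in `Fin d`: at every vertex, each colour
occurs on exactly one of the incident edges. -/
structure LegalLabelling (T : SimpleGraph V) (d : ℕ) where
  label : T.EdgeLabeling (Fin d)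
  bijective : ∀ v : V,
    Function.Bijective (fun w : T.neighborSet v => label.get v w.1 w.2)

namespace LegalLabelling

variable {d : ℕ} (l : LegalLabelling T d)

/-- The bijection between the edges at `v` (given by the neighbours of `v`) and the colours. -/
noncomputable def equivAt (v : V) : T.neighborSet v ≃ Fin d :=
  Equiv.ofBijective _ (l.bijective v)

/-- The local action `σ(g, v) = l_{g v} ∘ g ∘ l_v⁻¹` of an automorphism `g` at a vertex `v`. -/
noncomputable def localAction (g : T ≃g T) (v : V) : Equiv.Perm (Fin d) :=
  ((l.equivAt v).symm.trans (g.mapNeighborSet v)).trans (l.equivAt (g v))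

theorem localAction_label (g : T ≃g T) {v w : V} (h : T.Adj v w) :
    l.localAction g v (l.label.get v w h) = l.label.get (g v) (g w) (g.map_adj_iff.2 h) := by
  have h1 : l.label.get v w h = l.equivAt v ⟨w, h⟩ := rfl
  rw [h1]
  simp only [localAction, Equiv.trans_apply, Equiv.symm_apply_apply]
  rfl

theorem localAction_eq (g : T ≃g T) (v : V) (a : Equiv.Perm (Fin d))
    (ha : ∀ (w : V) (h : T.Adj v w),
      a (l.label.get v w h) = l.label.get (g v) (g w) (g.map_adj_iff.2 h)) :
    l.localAction g v = a := by
  ext1 i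
  obtain ⟨⟨w, h⟩, rfl⟩ := (l.bijective v).2 i
  exact (l.localAction_label g h).trans (ha w h).symm

theorem localAction_one (v : V) : l.localAction 1 v = 1 :=
  l.localAction_eq 1 v 1 fun _ _ => rfl

theorem localAction_mul (g h : T ≃g T) (v : V) :
    l.localAction (g * h) v = l.localAction g (h v) * l.localAction h v := by
  refine l.localAction_eq _ _ _ fun w hw => ?_
  rw [Equiv.Perm.mul_apply, l.localAction_label, l.localAction_label]
  rfl

theorem localAction_inv (g : T ≃g T) (v : V) :
    l.localAction g⁻¹ v = (l.localAction g (g⁻¹ v))⁻¹ := by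
  rw [eq_inv_iff_mul_eq_one, mul_eq_one_iff_eq_inv, eq_comm, inv_eq_iff_mul_eq_one,
    ← l.localAction_mul, mul_inv_cancel, l.localAction_one]

/-- The Burger–Mozes universal group `U_1(F)`: all automorphisms all of whose local actions
lie in `F`. -/
noncomputable def universalGroup (F : Subgroup (Equiv.Perm (Fin d))) : Subgroup (T ≃g T) where
  carrier := {g | ∀ v, l.localAction g v ∈ F}
  one_mem' v := by rw [l.localAction_one]; exact F.one_mem
  mul_mem' {g h} hg hh v := by
    rw [l.localAction_mul]; exact F.mul_mem (hg _) (hh _)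
  inv_mem' {g} hg v := by
    rw [l.localAction_inv]; exact F.inv_mem (hg _)

end LegalLabelling

end Tree

end TreeGroups

universe w u

/-! Write U = `l.universalGroup F` and U⁺ = `plusGroup U 1`. Let h lie in the closure of φ(U⁺), and
take an ultrafilter on U⁺ along which φ tends to h.

If some vertex has a constant image along it, local finiteness makes it converge in Aut(T). The
limit lies in U⁺, since U is closed and U⁺ contains the edge fixators of U, so h is a value of φ.

Otherwise every vertex escapes. For each edge, the ultrafilter pushes all vertices into one of the
two half-trees. If x fixes that half-tree pointwise, then g⁻¹xg → 1, while φ(g⁻¹xg) → h⁻¹φ(x)h;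
hence φ(x) = 1 (`map_eq_one_of_eventually_mem_halfTree`). Conjugation handles the other half-tree
(`exists_mem_plusGroup_mapsTo`). Every edge fixator is a product of two half-tree fixators (`glue`),
so φ is trivial. If F acts semiregularly, the conjugation is not available, but U⁺ = 1.

Under the extra hypotheses on F, U⁺ has index at most two in U, so φ(U) is a union of at most two
translates of a closed set. -/

namespace TreeGroups

/-! ### Half-trees and gluing of automorphisms along an edge -/

section Graph

variable {V : Type*} {T : SimpleGraph V}

theorem forall_of_adj (hT : T.Preconnected) {p : V → Prop} {a : V} (ha : p a)
    (h : ∀ x y, T.Adj x y → p x → p y) (x : V) : p x := by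
  obtain ⟨q⟩ := hT a x
  induction q with
  | nil => exact ha
  | cons hadj _ ih => exact ih (h _ _ hadj ha)

/-- The half-tree containing `a` that is cut off by removing the edge `{a, b}`. -/
def halfTree (T : SimpleGraph V) (a b : V) : Set V :=
  {y | (T.deleteEdges {s(a, b)}).Reachable a y}

theorem left_mem_halfTree (a b : V) : a ∈ halfTree T a b :=
  SimpleGraph.Reachable.refl a

theorem right_notMem_halfTree (hT : T.IsAcyclic) {a b : V} (hab : T.Adj a b) :
    b ∉ halfTree T a b :=
  SimpleGraph.isBridge_iff.1 (SimpleGraph.isAcyclic_iff_forall_isBridge.1 hT hab)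

theorem mem_halfTree_of_adj {a b y z : V} (hy : y ∈ halfTree T a b)
    (hyz : T.Adj y z) (h : s(y, z) ≠ s(a, b)) : z ∈ halfTree T a b := by
  refine SimpleGraph.Reachable.trans hy (SimpleGraph.Adj.reachable ?_)
  rw [SimpleGraph.deleteEdges_adj]
  exact ⟨hyz, h⟩

theorem eq_and_eq_of_adj_of_notMem_halfTree (hT : T.IsAcyclic) {a b y z : V} (hab : T.Adj a b)
    (hy : y ∈ halfTree T a b) (hyz : T.Adj y z) (hz : z ∉ halfTree T a b) : y = a ∧ z = b := by
  by_contra hne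
  refine hz (mem_halfTree_of_adj hy hyz fun h => ?_)
  rcases Sym2.eq_iff.1 h with h | ⟨rfl, -⟩
  · exact hne h
  · exact right_notMem_halfTree hT hab hy

theorem halfTree_symm (hT : T.IsTree) {a b : V} (hab : T.Adj a b) :
    halfTree T b a = (halfTree T a b)ᶜ := by
  have hs : ∀ x y : V, s(x, y) ≠ s(a, b) → s(x, y) ≠ s(b, a) := fun x y h => by
    rwa [Sym2.eq_swap (a := b)]
  refine Set.Subset.antisymm (fun y hy => ?_) (fun y hy => ?_)
  · intro hy'
    refine right_notMem_halfTree hT.2 hab (SimpleGraph.Reachable.trans hy' ?_)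
    have h : (T.deleteEdges {s(b, a)}).Reachable b y := hy
    rw [Sym2.eq_swap] at h
    exact h.symm
  · have key : ∀ y, y ∈ halfTree T a b ∨ y ∈ halfTree T b a := by
      refine forall_of_adj hT.1.preconnected (a := a) (Or.inl (left_mem_halfTree a b)) ?_
      intro x z hxz hx
      by_cases h : s(x, z) = s(a, b)
      · rcases Sym2.eq_iff.1 h with ⟨rfl, rfl⟩ | ⟨rfl, rfl⟩
        · exact Or.inr (left_mem_halfTree _ _)
        · exact Or.inl (left_mem_halfTree _ _)
      · exact hx.imp (fun hx => mem_halfTree_of_adj hx hxz h)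
          (fun hx => mem_halfTree_of_adj hx hxz (hs _ _ h))
    exact (key y).resolve_left hy

theorem apply_mem_halfTree (g : T ≃g T) {a b y : V} (hy : y ∈ halfTree T a b) :
    g y ∈ halfTree T (g a) (g b) := by
  obtain ⟨p⟩ : (T.deleteEdges {s(a, b)}).Reachable a y := hy
  suffices h : ∀ x y, (T.deleteEdges {s(a, b)}).Walk x y →
      (T.deleteEdges {s(g a, g b)}).Reachable (g x) (g y) from h a y p
  intro x y p
  induction p with
  | nil => exact SimpleGraph.Reachable.refl _
  | cons hadj _ ih =>
    refine SimpleGraph.Reachable.trans (SimpleGraph.Adj.reachable ?_) ih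
    rw [SimpleGraph.deleteEdges_adj] at hadj ⊢
    refine ⟨g.map_adj_iff.2 hadj.1, fun h => hadj.2 ?_⟩
    have h' : Sym2.map g s(_, _) = Sym2.map g s(a, b) := h
    exact Sym2.map.injective g.injective h'

theorem apply_mem_halfTree_iff (g : T ≃g T) {a b y : V} (ha : g a = a) (hb : g b = b) :
    g y ∈ halfTree T a b ↔ y ∈ halfTree T a b := by
  refine ⟨fun h => ?_, fun h => ?_⟩
  · have := apply_mem_halfTree g⁻¹ h
    have e : ∀ x, g⁻¹ (g x) = x := g.symm_apply_apply
    rwa [e, show g⁻¹ a = a by simpa [ha] using e a, show g⁻¹ b = b by simpa [hb] using e b] at this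
  · simpa [ha, hb] using apply_mem_halfTree g h

/-- A walk from `c` avoiding the edge `{c, v}` never meets `v`, hence never uses `{v, a}`. -/
theorem halfTree_subset_halfTree (hT : T.IsAcyclic) {v a c : V} (hc : T.Adj v c)
    (ha : T.Adj v a) (hca : c ≠ a) : halfTree T c v ⊆ halfTree T v a := by
  have key : ∀ x y, (T.deleteEdges {s(c, v)}).Walk x y → x ∈ halfTree T v a →
      x ∈ halfTree T c v → y ∈ halfTree T v a := by
    intro x y p
    induction p with
    | nil => exact fun hx _ => hx
    | cons hadj _ ih =>
      intro hx hx'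
      rw [SimpleGraph.deleteEdges_adj] at hadj
      have hw := mem_halfTree_of_adj hx' hadj.1 hadj.2
      refine ih (mem_halfTree_of_adj hx hadj.1 fun h => ?_) hw
      rcases Sym2.eq_iff.1 h with ⟨rfl, -⟩ | ⟨-, rfl⟩
      · exact right_notMem_halfTree hT hc.symm hx'
      · exact right_notMem_halfTree hT hc.symm hw
  rintro y ⟨p⟩
  refine key c y p (mem_halfTree_of_adj (left_mem_halfTree v a) hc fun h => ?_)
    (left_mem_halfTree c v)
  rcases Sym2.eq_iff.1 h with ⟨-, h⟩ | ⟨h, -⟩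
  · exact hca h
  · exact ha.ne h

open Classical in
/-- The automorphism that is trivial on the half-tree of `a` and agrees on the complementary
half-tree with an automorphism fixing both `a` and `b`. -/
noncomputable def glue (hT : T.IsAcyclic) {a b : V} (hab : T.Adj a b) (g : T ≃g T)
    (ha : g a = a) (hb : g b = b) : T ≃g T where
  toFun y := if y ∈ halfTree T a b then y else g y
  invFun y := if y ∈ halfTree T a b then y else g.symm y
  left_inv y := by
    by_cases hy : y ∈ halfTree T a b
    · simp [hy]
    · simp [hy, apply_mem_halfTree_iff g ha hb]
  right_inv y := by
    by_cases hy : y ∈ halfTree T a b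
    · simp [hy]
    · have : g.symm y ∉ halfTree T a b := by
        rwa [← apply_mem_halfTree_iff g ha hb, g.apply_symm_apply]
      simp [hy, this]
  map_rel_iff' {y z} := by
    -- The only edge between the two half-trees is `{a, b}`, whose ends `g` fixes.
    have key : ∀ y z, y ∈ halfTree T a b → z ∉ halfTree T a b → (T.Adj y (g z) ↔ T.Adj y z) := by
      intro y z hy hz
      refine ⟨fun h => ?_, fun h => ?_⟩
      · have := eq_and_eq_of_adj_of_notMem_halfTree hT hab hy h
          (by rwa [apply_mem_halfTree_iff g ha hb])
        rw [this.1, g.injective (this.2.trans hb.symm)]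
        exact hab
      · have := eq_and_eq_of_adj_of_notMem_halfTree hT hab hy h hz
        rw [this.1, this.2, hb]
        exact hab
    change T.Adj (if y ∈ halfTree T a b then y else g y)
      (if z ∈ halfTree T a b then z else g z) ↔ T.Adj y z
    by_cases hy : y ∈ halfTree T a b <;> by_cases hz : z ∈ halfTree T a b
    · simp [hy, hz]
    · simpa [hy, hz] using key y z hy hz
    · simpa [hy, hz, T.adj_comm] using key z y hz hy
    · simpa [hy, hz] using g.map_adj_iff

section Glue

variable (hT : T.IsAcyclic) {a b : V} (hab : T.Adj a b) (g : T ≃g T) (ha : g a = a) (hb : g b = b)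

theorem glue_of_mem {y : V} (hy : y ∈ halfTree T a b) : glue hT hab g ha hb y = y :=
  if_pos hy

theorem glue_of_notMem {y : V} (hy : y ∉ halfTree T a b) : glue hT hab g ha hb y = g y :=
  if_neg hy

theorem glue_of_adj {y z : V} (hy : y ∉ halfTree T a b) (hyz : T.Adj y z) :
    glue hT hab g ha hb z = g z := by
  by_cases hz : z ∈ halfTree T a b
  · rw [glue_of_mem hT hab g ha hb hz,
      (eq_and_eq_of_adj_of_notMem_halfTree hT hab hz hyz.symm hy).1, ha]
  · exact glue_of_notMem hT hab g ha hb hz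

theorem glue_of_adj_of_mem {y z : V} (hy : y ∈ halfTree T a b) (hyz : T.Adj y z) :
    glue hT hab g ha hb z = z := by
  by_cases hz : z ∈ halfTree T a b
  · exact glue_of_mem hT hab g ha hb hz
  · rw [glue_of_notMem hT hab g ha hb hz,
      (eq_and_eq_of_adj_of_notMem_halfTree hT hab hy hyz hz).2, hb]

end Glue

end Graph

/-! ### Local actions and automorphisms with constant local action -/

section Labelling

variable {V : Type*} {T : SimpleGraph V} {d : ℕ}

namespace LegalLabelling

variable (l : LegalLabelling T d)

theorem localAction_congr {g h : T ≃g T} {v : V} (hv : g v = h v)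
    (H : ∀ w, T.Adj v w → g w = h w) : l.localAction g v = l.localAction h v := by
  refine l.localAction_eq _ _ _ fun w hw => ?_
  rw [l.localAction_label]
  have H' := H w hw
  congr 1 <;> simp_all

/-- On the star of any vertex the glued map agrees with `1` or with `g`, even across the edge `{a,
b}`, because both ends are fixed. This is the independence property of U. -/
theorem glue_mem_universalGroup {F : Subgroup (Equiv.Perm (Fin d))} (hT : T.IsAcyclic) {a b : V}
    (hab : T.Adj a b) {g : T ≃g T} (hg : g ∈ l.universalGroup F) (ha : g a = a) (hb : g b = b) :
    glue hT hab g ha hb ∈ l.universalGroup F := by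
  intro v
  by_cases hv : v ∈ halfTree T a b
  · rw [l.localAction_congr (h := 1) (glue_of_mem hT hab g ha hb hv)
      fun w hw => glue_of_adj_of_mem hT hab g ha hb hv hw, l.localAction_one]
    exact F.one_mem
  · rw [l.localAction_congr (h := g) (glue_of_notMem hT hab g ha hb hv)
      fun w hw => glue_of_adj hT hab g ha hb hv hw]
    exact hg v

/-- The neighbour of `v` along the edge of colour `i`. -/
noncomputable def nbr (v : V) (i : Fin d) : V := (l.equivAt v).symm i

theorem adj_nbr (v : V) (i : Fin d) : T.Adj v (l.nbr v i) := ((l.equivAt v).symm i).2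

theorem label_nbr (v : V) (i : Fin d) (h : T.Adj v (l.nbr v i)) :
    l.label.get v (l.nbr v i) h = i :=
  (l.equivAt v).apply_symm_apply i

theorem nbr_label {v w : V} (h : T.Adj v w) : l.nbr v (l.label.get v w h) = w :=
  congrArg Subtype.val ((l.equivAt v).symm_apply_apply ⟨w, h⟩)

theorem label_comm {v w : V} (h : T.Adj v w) : l.label.get v w h = l.label.get w v h.symm := by
  unfold SimpleGraph.EdgeLabeling.get
  congr 1
  exact Subtype.ext Sym2.eq_swap

theorem nbr_nbr (v : V) (i : Fin d) : l.nbr (l.nbr v i) i = v := by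
  have h := l.nbr_label (l.adj_nbr v i).symm
  rwa [← l.label_comm (l.adj_nbr v i), l.label_nbr] at h

theorem apply_nbr (g : T ≃g T) (v : V) (i : Fin d) :
    g (l.nbr v i) = l.nbr (g v) (l.localAction g v i) := by
  have h := l.localAction_label g (l.adj_nbr v i)
  rw [l.label_nbr] at h
  rw [h, l.nbr_label]

/-- The endpoint of the walk starting at `c` whose colours are the images under `a` of the colours
of a given walk. -/
noncomputable def recolour (a : Equiv.Perm (Fin d)) : ∀ {u v : V}, T.Walk u v → V → V
  | _, _, .nil, c => c
  | _, _, .cons h p, c => recolour a p (l.nbr c (a (l.label.get _ _ h)))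

theorem recolour_concat (a : Equiv.Perm (Fin d)) {u v w : V} (p : T.Walk u v) (h : T.Adj v w)
    (c : V) : l.recolour a (p.concat h) c = l.nbr (l.recolour a p c) (a (l.label.get v w h)) := by
  induction p generalizing c with
  | nil => rfl
  | cons _ _ ih => exact ih h _

/-- The image of `y` is reached from `v` by following the colours of the path from `v` to `y`,
permuted by `a`. -/
theorem exists_recolouring (hT : T.IsTree) (a : Equiv.Perm (Fin d)) (v : V) :
    ∃ f : V → V, f v = v ∧ ∀ y i, f (l.nbr y i) = l.nbr (f y) (a i) := by
  choose p hp using fun y => (hT.existsUnique_path v y).exists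
  refine ⟨fun y => l.recolour a (p y) v, ?_, fun y i => ?_⟩
  · have : p v = .nil := (hT.existsUnique_path v v).unique (hp v) .nil
    change l.recolour a (p v) v = v
    rw [this]
    rfl
  · have hadj := l.adj_nbr y i
    change l.recolour a (p (l.nbr y i)) v = l.nbr (l.recolour a (p y) v) (a i)
    -- The paths to `y` and to its neighbour differ by one final edge; the case split decides which
    -- is longer.
    by_cases hy : y ∈ (p (l.nbr y i)).support
    · rw [hT.2.path_concat (hp y) (hp _) hadj hy, recolour_concat, l.label_nbr]
    · have hz := hT.2.mem_support_of_ne_mem_support_of_adj_of_isPath (hp y) (hp _) hadj hy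
      rw [hT.2.path_concat (hp _) (hp y) hadj.symm hz, recolour_concat, ← l.label_comm hadj,
        l.label_nbr, l.nbr_nbr]

/-- The recolourings by `a` and by `a⁻¹` from `v` are mutually inverse. -/
theorem exists_localAction_eq (hT : T.IsTree) (a : Equiv.Perm (Fin d)) (v : V) :
    ∃ g : T ≃g T, g v = v ∧ ∀ y, l.localAction g y = a := by
  have inv : ∀ (a b : Equiv.Perm (Fin d)) (f g : V → V), (∀ i, b (a i) = i) → f v = v → g v = v →
      (∀ y i, f (l.nbr y i) = l.nbr (f y) (a i)) → (∀ y i, g (l.nbr y i) = l.nbr (g y) (b i)) →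
      ∀ y, g (f y) = y := by
    intro a b f g hab hf hg hf' hg'
    refine forall_of_adj hT.1.preconnected (a := v) (by rw [hf, hg]) fun x y hxy hx => ?_
    rw [← l.nbr_label hxy, hf', hg', hx, hab]
  obtain ⟨f, hf, hf'⟩ := l.exists_recolouring hT a v
  obtain ⟨g, hg, hg'⟩ := l.exists_recolouring hT a⁻¹ v
  have hgf := inv a a⁻¹ f g (by simp) hf hg hf' hg'
  have hfg := inv a⁻¹ a g f (by simp) hg hf hg' hf'
  have adj : ∀ (a : Equiv.Perm (Fin d)) (f : V → V), (∀ y i, f (l.nbr y i) = l.nbr (f y) (a i)) →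
      ∀ y z, T.Adj y z → T.Adj (f y) (f z) := by
    intro a f hf y z h
    rw [← l.nbr_label h, hf]
    exact l.adj_nbr _ _
  let x : T ≃g T :=
    { toFun := f, invFun := g, left_inv := hgf, right_inv := hfg,
      map_rel_iff' := fun {y z} =>
        ⟨fun h => by
          have h' := adj _ g hg' _ _ h
          change T.Adj (g (f y)) (g (f z)) at h'
          rwa [hgf, hgf] at h', adj _ f hf' y z⟩ }
  refine ⟨x, hf, fun y => Equiv.ext fun i => ?_⟩
  have h1 : l.nbr (x y) (a i) = l.nbr (x y) (l.localAction x y i) :=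
    (hf' y i).symm.trans (l.apply_nbr x y i)
  have h2 := l.label_nbr (x y) (a i) (l.adj_nbr _ _)
  have h3 := l.label_nbr (x y) (l.localAction x y i) (l.adj_nbr _ _)
  rw [← h3, ← h2]
  congr 1
  exact h1.symm

theorem nbr_injective (v : V) : Function.Injective (l.nbr v) :=
  Subtype.val_injective.comp (l.equivAt v).symm.injective

end LegalLabelling

end Labelling

end TreeGroups

namespace TreeGroups

open Filter Topology

/-! ### Convergence of ultrafilters of automorphisms -/

section Compactness

variable {V : Type*} {T : SimpleGraph V} {d : ℕ}

theorem tendsto_aut_iff {ι : Type*} {L : Filter ι} {f : ι → T ≃g T} {g : T ≃g T} :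
    Tendsto f L (𝓝 g) ↔ ∀ x, ∀ᶠ i in L, f i x = g x := by
  let _ : TopologicalSpace V := ⊥
  have : DiscreteTopology V := ⟨rfl⟩
  rw [nhds_induced, tendsto_comap_iff, tendsto_pi_nhds]
  simp only [nhds_discrete, tendsto_pure, Function.comp_apply]

/-- If the displacement of one vertex is constant along an ultrafilter on the automorphism group
of a locally finite connected graph, then the ultrafilter converges. -/
theorem exists_forall_eventually_eq (hT : T.Preconnected)
    (hfin : ∀ v, (T.neighborSet v).Finite) {ι : Type*} (W : Ultrafilter ι) (e : ι → T ≃g T)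
    {p q : V} (hpq : ∀ᶠ i in W, e i p = q) : ∃ f : T ≃g T, ∀ x, ∀ᶠ i in W, e i x = f x := by
  have key : ∀ (e : ι → T ≃g T) (p q : V), (∀ᶠ i in W, e i p = q) →
      ∀ x, ∃ y, ∀ᶠ i in W, e i x = y := by
    intro e p q hpq
    refine forall_of_adj hT (a := p) ⟨q, hpq⟩ ?_
    rintro x z hxz ⟨y, hy⟩
    have h : ∀ᶠ i in W, ∃ t ∈ T.neighborSet y, e i z = t := by
      filter_upwards [hy] with i hi
      exact ⟨e i z, hi ▸ (e i).map_adj_iff.2 hxz, rfl⟩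
    obtain ⟨t, -, ht⟩ := (Ultrafilter.eventually_exists_mem_iff (hfin y)).1 h
    exact ⟨t, ht⟩
  have hqp : ∀ᶠ i in W, (e i)⁻¹ q = p := by
    filter_upwards [hpq] with i hi
    rw [← hi]
    exact (e i).symm_apply_apply p
  choose f hf using key e p q hpq
  choose f' hf' using key (fun i => (e i)⁻¹) q p hqp
  refine ⟨⟨⟨f, f', fun x => ?_, fun x => ?_⟩, fun {x y} => ?_⟩, hf⟩
  · obtain ⟨i, h1, h2⟩ := ((hf x).and (hf' (f x))).exists
    rw [← h2, ← h1]
    exact (e i).symm_apply_apply x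
  · obtain ⟨i, h1, h2⟩ := ((hf (f' x)).and (hf' x)).exists
    rw [← h1, ← h2]
    exact (e i).apply_symm_apply x
  · obtain ⟨i, h1, h2⟩ := ((hf x).and (hf y)).exists
    change T.Adj (f x) (f y) ↔ T.Adj x y
    rw [← h1, ← h2]
    exact (e i).map_adj_iff

/-- A local action depends only on the values on a finite star, so U is closed. -/
theorem LegalLabelling.mem_universalGroup_of_eventually (l : LegalLabelling T d)
    {F : Subgroup (Equiv.Perm (Fin d))} (hfin : ∀ v, (T.neighborSet v).Finite)
    {ι : Type*} {L : Filter ι} [L.NeBot] {e : ι → T ≃g T} {f : T ≃g T}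
    (he : ∀ i, e i ∈ l.universalGroup F) (hf : ∀ x, ∀ᶠ i in L, e i x = f x) :
    f ∈ l.universalGroup F := by
  intro v
  have h : ∀ᶠ i in L, ∀ w ∈ T.neighborSet v, e i w = f w :=
    (eventually_all_finite (hfin v)).2 fun w _ => hf w
  obtain ⟨i, h1, h2⟩ := ((hf v).and h).exists
  rw [← l.localAction_congr h1 h2]
  exact he i v

end Compactness

/-! ### Edge fixators and the group U⁺ -/

section Plus

variable {V : Type*} {T : SimpleGraph V} {d : ℕ}

theorem plusGroup_one (hT : T.IsAcyclic) (G : Subgroup (T ≃g T)) :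
    plusGroup G 1 =
      Subgroup.closure {g | g ∈ G ∧ ∃ a b, T.Adj a b ∧ g a = a ∧ g b = b} := by
  unfold plusGroup
  congr 1
  ext g
  refine and_congr_right fun _ => exists_congr fun a => exists_congr fun b =>
    and_congr_right fun hab => ?_
  have mem : ∀ v x, x ∈ closedBall T v 1 ↔ T.Adj v x ∨ v = x := fun v x =>
    SimpleGraph.edist_le_one_iff_adj_or_eq
  refine ⟨fun h => ⟨h a ?_, h b ?_⟩, ?_⟩
  · simp [mem, hab.symm]
  · simp [mem, hab]
  · rintro ⟨ha, hb⟩ x ⟨hxa, hxb⟩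
    rw [mem] at hxa hxb
    rcases hxa with hxa | rfl
    · rcases hxb with hxb | rfl
      -- A common neighbour of `a` and `b` would close a triangle.
      · refine absurd ?_ (right_notMem_halfTree hT hab)
        refine mem_halfTree_of_adj (mem_halfTree_of_adj (left_mem_halfTree a b) hxa ?_)
          hxb.symm ?_
        · simp [hxb.ne', hab.ne]
        · simp [hxa.ne', hxb.ne']
      · exact hb
    · exact ha

theorem mem_plusGroup (hT : T.IsAcyclic) {G : Subgroup (T ≃g T)} {g : T ≃g T} (hg : g ∈ G)
    {a b : V} (hab : T.Adj a b) (ha : g a = a) (hb : g b = b) : g ∈ plusGroup G 1 := by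
  rw [plusGroup_one hT]
  exact Subgroup.subset_closure ⟨hg, a, b, hab, ha, hb⟩

theorem plusGroup_le (hT : T.IsAcyclic) (G : Subgroup (T ≃g T)) : plusGroup G 1 ≤ G := by
  rw [plusGroup_one hT, Subgroup.closure_le]
  exact fun g hg => hg.1

namespace LegalLabelling

variable (l : LegalLabelling T d) {F : Subgroup (Equiv.Perm (Fin d))}

theorem finite_neighborSet (l : LegalLabelling T d) (v : V) : (T.neighborSet v).Finite :=
  Set.finite_coe_iff.1 (Finite.of_equiv _ (l.equivAt v).symm)

theorem localAction_apply_eq_self {g : T ≃g T} {v w : V} (h : T.Adj v w) (hv : g v = v)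
    (hw : g w = w) : l.localAction g v (l.label.get v w h) = l.label.get v w h := by
  rw [l.localAction_label]
  congr 1

theorem exists_mem_universalGroup (hT : T.IsTree) {a : Equiv.Perm (Fin d)} (ha : a ∈ F) (v : V) :
    ∃ g ∈ l.universalGroup F, g v = v ∧ ∀ y, l.localAction g y = a := by
  obtain ⟨g, hg, hg'⟩ := l.exists_localAction_eq hT a v
  exact ⟨g, fun y => hg' y ▸ ha, hg, hg'⟩

theorem exists_mem_plusGroup (hT : T.IsTree) {a : Equiv.Perm (Fin d)} (ha : a ∈ F) {i : Fin d}
    (hi : a i = i) (v : V) :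
    ∃ g ∈ plusGroup (l.universalGroup F) 1, g v = v ∧ ∀ y, l.localAction g y = a := by
  obtain ⟨g, hgU, hg, hg'⟩ := l.exists_mem_universalGroup hT ha v
  refine ⟨g, mem_plusGroup hT.2 hgU (l.adj_nbr v i) hg ?_, hg, hg'⟩
  rw [l.apply_nbr, hg, hg', hi]

/-- If some element of `F` fixes one colour and moves another one, then every half-tree can be
moved into the complementary half-tree. -/
theorem exists_mem_plusGroup_mapsTo (hT : T.IsTree) {α : Equiv.Perm (Fin d)} (hα : α ∈ F)
    {i j : Fin d} (hi : α i = i) (hj : α j ≠ j) {a b : V} (hab : T.Adj a b) :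
    ∃ x ∈ plusGroup (l.universalGroup F) 1, Set.MapsTo x (halfTree T a b) (halfTree T b a) := by
  have key : ∀ v, ∃ x ∈ plusGroup (l.universalGroup F) 1,
      Set.MapsTo x (halfTree T (l.nbr v j) v) (halfTree T v (l.nbr v j)) := by
    intro v
    obtain ⟨x, hx, hv, hx'⟩ := l.exists_mem_plusGroup hT hα hi v
    refine ⟨x, hx, fun y hy => ?_⟩
    have h := apply_mem_halfTree x hy
    rw [l.apply_nbr, hv, hx'] at h
    exact halfTree_subset_halfTree hT.2 (l.adj_nbr v _) (l.adj_nbr v j)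
      (fun e => hj (l.nbr_injective v e)) h
  -- If `{a, b}` has colour `j`, turning about `b` suffices. Otherwise turn about the `j`-neighbour
  -- `c` of `b`: the half-tree of `a` lies in that of `b` cut off from `c`, which is moved into the
  -- half-tree of `c`, inside that of `b` cut off from `a`.
  by_cases hbj : l.nbr b j = a
  · obtain ⟨x, hx, hx'⟩ := key b
    rw [hbj] at hx'
    exact ⟨x, hx, hx'⟩
  · obtain ⟨x, hx, hx'⟩ := key (l.nbr b j)
    rw [l.nbr_nbr] at hx'
    have hb := l.adj_nbr b j
    exact ⟨x, hx, fun y hy => halfTree_subset_halfTree hT.2 hb hab.symm hbj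
      (hx' (halfTree_subset_halfTree hT.2 hab.symm hb (Ne.symm hbj) hy))⟩

/-- A fixed edge forces trivial local actions at its ends, so all adjacent edges are fixed too, and
this spreads over the tree. -/
theorem eq_one_of_semiregular (hT : T.IsTree)
    (hF : ∀ α ∈ F, ∀ i, α i = i → α = 1) {g : T ≃g T} (hg : g ∈ l.universalGroup F) {a b : V}
    (hab : T.Adj a b) (ha : g a = a) (hb : g b = b) : g = 1 := by
  have hlocal : ∀ v w, T.Adj v w → g v = v → g w = w → l.localAction g v = 1 := fun v w h hv hw =>
    hF _ (hg v) _ (l.localAction_apply_eq_self h hv hw)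
  have key : ∀ x, g x = x ∧ l.localAction g x = 1 := by
    refine forall_of_adj hT.1.preconnected (a := a) ⟨ha, hlocal a b hab ha hb⟩ ?_
    rintro x y hxy ⟨hx, hx'⟩
    have hy : g y = y := by
      rw [← l.nbr_label hxy, l.apply_nbr, hx, hx', Equiv.Perm.one_apply]
    exact ⟨hy, hlocal y x hxy.symm hy hx⟩
  exact RelIso.ext fun x => (key x).1

end LegalLabelling

end Plus

/-! ### The closed range property -/

section ClosedRange

variable {V : Type*} {T : SimpleGraph V} {d : ℕ}

theorem map_eq_one_of_eventually_mem_halfTree (hT : T.IsTree) {G : Subgroup (T ≃g T)}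
    {H : Type*} [Group H] [TopologicalSpace H] [IsTopologicalGroup H] [T2Space H]
    {φ : G →* H} (hφ : Continuous φ) {L : Filter G} [L.NeBot] {h : H} (hL : Tendsto φ L (𝓝 h))
    (hinf : ∀ p q : V, ∀ᶠ g : G in L, g.1 p ≠ q) {a b p : V} (hab : T.Adj a b)
    (hp : ∀ᶠ g : G in L, g.1 p ∈ halfTree T a b) {x : G}
    (hx : ∀ y ∈ halfTree T a b, x.1 y = y) : φ x = 1 := by
  -- Images of adjacent vertices can be separated only by one of them being `a`, which escape rules
  -- out eventually.
  have hall : ∀ q, ∀ᶠ g : G in L, g.1 q ∈ halfTree T a b := by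
    refine forall_of_adj hT.1.preconnected hp fun y z hyz hy => ?_
    filter_upwards [hy, hinf y a] with g hg hga
    by_contra hz
    exact hga (eq_and_eq_of_adj_of_notMem_halfTree hT.2 hab hg (g.1.map_adj_iff.2 hyz) hz).1
  have h1 : Tendsto (fun g : G => g⁻¹ * x * g) L (𝓝 1) := by
    rw [tendsto_subtype_rng, Subgroup.coe_one, tendsto_aut_iff]
    intro q
    filter_upwards [hall q] with g hg
    change g.1.symm (x.1 (g.1 q)) = q
    rw [hx _ hg]
    exact g.1.symm_apply_apply q
  have h2 : Tendsto (fun g : G => φ (g⁻¹ * x * g)) L (𝓝 1) := by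
    have := (hφ.tendsto 1).comp h1
    rwa [map_one] at this
  have h3 : Tendsto (fun g : G => φ (g⁻¹ * x * g)) L (𝓝 (h⁻¹ * φ x * h)) := by
    simp only [map_mul, map_inv]
    exact (hL.inv.mul_const _).mul hL
  have h4 := tendsto_nhds_unique h3 h2
  rwa [mul_eq_one_iff_eq_inv, mul_eq_left] at h4

variable (l : LegalLabelling T d) {F : Subgroup (Equiv.Perm (Fin d))}

/-- An edge fixator is g = k(k⁻¹g), where the glued k is trivial on one half-tree and k⁻¹g on the
other. -/
theorem LegalLabelling.map_plusGroup_eq_one (hT : T.IsTree)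
    {H : Type*} [Group H] {φ : plusGroup (l.universalGroup F) 1 →* H}
    (hφ : ∀ (a b : V), T.Adj a b → ∀ (x : plusGroup (l.universalGroup F) 1),
      (∀ y ∈ halfTree T a b, x.1 y = y) → φ x = 1) (g : plusGroup (l.universalGroup F) 1) :
    φ g = 1 := by
  suffices h : plusGroup (l.universalGroup F) 1 ≤ φ.ker.map (Subgroup.subtype _) by
    obtain ⟨g', hg', e⟩ := h g.2
    rw [← Subtype.ext e]
    exact hg'
  conv_lhs => rw [plusGroup_one hT.2]
  rw [Subgroup.closure_le]
  rintro g ⟨hg, a, b, hab, ha, hb⟩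
  let k := glue hT.2 hab g ha hb
  have hka : k a = a := glue_of_mem hT.2 hab g ha hb (left_mem_halfTree a b)
  have hkb : k b = b :=
    (glue_of_notMem hT.2 hab g ha hb (right_notMem_halfTree hT.2 hab)).trans hb
  have hk : k ∈ plusGroup (l.universalGroup F) 1 :=
    mem_plusGroup hT.2 (l.glue_mem_universalGroup hT.2 hab hg ha hb) hab hka hkb
  have hg' := mem_plusGroup hT.2 hg hab ha hb
  refine ⟨⟨g, hg'⟩, ?_, rfl⟩
  have h1 : φ ⟨k, hk⟩ = 1 := hφ a b hab _ fun y hy => glue_of_mem hT.2 hab g ha hb hy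
  have h2 : φ (⟨k, hk⟩⁻¹ * ⟨g, hg'⟩) = 1 := by
    refine hφ b a hab.symm _ fun y hy => ?_
    rw [halfTree_symm hT hab] at hy
    change k.symm (g y) = y
    rw [← glue_of_notMem hT.2 hab g ha hb hy]
    exact k.symm_apply_apply y
  rw [map_mul, map_inv, h1, inv_one, one_mul] at h2
  exact h2

theorem LegalLabelling.closedRange_plusGroup (hT : T.IsTree) :
    HasClosedRangeProperty.{w} (plusGroup (l.universalGroup F) 1) := by
  intro H _ _ _ _ φ hφ
  have htriv : (∀ x, φ x = 1) → IsClosed (Set.range φ) := fun h => by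
    have : Set.range φ = {1} := by
      ext y
      simp [h, eq_comm]
    rw [this]
    exact isClosed_singleton
  by_cases hF : ∀ α ∈ F, ∀ i, α i = i → α = 1
  · refine htriv fun x => ?_
    have : plusGroup (l.universalGroup F) 1 ≤ ⊥ := by
      rw [plusGroup_one hT.2, Subgroup.closure_le]
      rintro g ⟨hg, a, b, hab, ha, hb⟩
      exact l.eq_one_of_semiregular hT hF hg hab ha hb
    rw [show x = 1 from Subtype.ext (this x.2), map_one]
  push Not at hF
  obtain ⟨α, hα, i, hi, hα1⟩ := hF
  obtain ⟨j, hj⟩ : ∃ j, α j ≠ j := by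
    by_contra! h
    exact hα1 (Equiv.ext h)
  refine isClosed_of_closure_subset fun h hh => ?_
  have hne : (comap φ (𝓝 h)).NeBot := comap_neBot fun t ht => by
    obtain ⟨_, hy, g, rfl⟩ := mem_closure_iff_nhds.1 hh t ht
    exact ⟨g, hy⟩
  -- An ultrafilter decides, for each edge, which half-tree receives the images, and turns the
  -- failure of escape into a constant image.
  let W := Ultrafilter.of (comap φ (𝓝 h))
  have hW : Tendsto φ W (𝓝 h) := tendsto_comap.mono_left (Ultrafilter.of_le _)
  by_cases hinf : ∀ p q : V, ∀ᶠ g : plusGroup (l.universalGroup F) 1 in W, g.1 p ≠ q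
  · have htriv' : ∀ x, φ x = 1 := by
      have swap : ∀ a b, T.Adj a b →
          (∀ x : plusGroup (l.universalGroup F) 1, (∀ y ∈ halfTree T a b, x.1 y = y) → φ x = 1) →
          ∀ x : plusGroup (l.universalGroup F) 1, (∀ y ∈ halfTree T b a, x.1 y = y) → φ x = 1 := by
        intro a b hab hfix x hx
        obtain ⟨z, hz, hz'⟩ := l.exists_mem_plusGroup_mapsTo hT hα hi hj hab
        have h1 := hfix (⟨z, hz⟩⁻¹ * x * ⟨z, hz⟩) fun y hy => by
          change z.symm (x.1 (z y)) = y
          rw [hx _ (hz' hy)]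
          exact z.symm_apply_apply y
        rw [map_mul, map_mul, map_inv, mul_eq_one_iff_eq_inv, mul_eq_left] at h1
        exact h1
      refine l.map_plusGroup_eq_one hT fun a b hab => ?_
      have hor : ∀ᶠ g : plusGroup (l.universalGroup F) 1 in W,
          g.1 a ∈ halfTree T a b ∨ g.1 a ∈ halfTree T b a := by
        refine Eventually.of_forall fun g => ?_
        rw [halfTree_symm hT hab]
        exact em _
      rcases Ultrafilter.eventually_or.1 hor with hW' | hW'
      · exact fun x => map_eq_one_of_eventually_mem_halfTree hT hφ hW hinf hab hW'
      · exact swap b a hab.symm fun x =>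
          map_eq_one_of_eventually_mem_halfTree hT hφ hW hinf hab.symm hW'
    rw [← (htriv htriv').closure_eq]
    exact hh
  · push Not at hinf
    obtain ⟨p, q, hpq⟩ := hinf
    obtain ⟨f, hf⟩ := exists_forall_eventually_eq hT.1.preconnected l.finite_neighborSet W
      (fun g => g.1) hpq
    have hfU : f ∈ l.universalGroup F := l.mem_universalGroup_of_eventually l.finite_neighborSet
      (fun g => plusGroup_le hT.2 _ g.2) hf
    -- Some `g` in U⁺ agrees with `f` on both ends of an edge, so `g⁻¹ * f` is an edge fixator.
    have hf1 : f ∈ plusGroup (l.universalGroup F) 1 := by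
      obtain ⟨g, h1, h2⟩ := ((hf p).and (hf (l.nbr p i))).exists
      have h3 : g.1⁻¹ * f ∈ plusGroup (l.universalGroup F) 1 := by
        refine mem_plusGroup hT.2 (mul_mem (inv_mem (plusGroup_le hT.2 _ g.2)) hfU)
          (l.adj_nbr p i) ?_ ?_
        · change g.1.symm (f p) = p
          rw [← h1]
          exact g.1.symm_apply_apply _
        · change g.1.symm (f (l.nbr p i)) = l.nbr p i
          rw [← h2]
          exact g.1.symm_apply_apply _
      simpa using mul_mem g.2 h3
    have hlim : Tendsto (fun g : plusGroup (l.universalGroup F) 1 => g) W (𝓝 ⟨f, hf1⟩) := by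
      rw [tendsto_subtype_rng, tendsto_aut_iff]
      exact hf
    exact ⟨⟨f, hf1⟩, tendsto_nhds_unique ((hφ.tendsto _).comp hlim) hW⟩

/-- The local action of `g` at `v` is a product of elements with fixed points, hence is realised by
some `x` in U⁺ fixing `v`. Then `x⁻¹ * g` fixes every edge at `v`. -/
theorem LegalLabelling.mem_plusGroup_of_fix (hT : T.IsTree)
    (hgen : (⨆ i : Fin d, MulAction.stabilizer F i) = ⊤) [Nonempty (Fin d)] {g : T ≃g T}
    (hg : g ∈ l.universalGroup F) {v : V} (hv : g v = v) :
    g ∈ plusGroup (l.universalGroup F) 1 := by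
  have key : ∀ α ∈ (⨆ i : Fin d, MulAction.stabilizer F i),
      ∃ x ∈ plusGroup (l.universalGroup F) 1, x v = v ∧ l.localAction x v = α := by
    intro α hα
    induction hα using Subgroup.iSup_induction' with
    | hp i α hα =>
      obtain ⟨x, hx, hxv, h⟩ := l.exists_mem_plusGroup hT α.2 (i := i) hα v
      exact ⟨x, hx, hxv, h v⟩
    | h1 => exact ⟨1, one_mem _, rfl, l.localAction_one v⟩
    | hmul α β _ _ hα hβ =>
      obtain ⟨x, hx, hxv, h⟩ := hα
      obtain ⟨y, hy, hyv, h'⟩ := hβ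
      refine ⟨x * y, mul_mem hx hy, ?_, ?_⟩
      · rw [RelIso.mul_apply, hyv, hxv]
      · rw [l.localAction_mul, hyv, h, h', Subgroup.coe_mul]
  obtain ⟨x, hx, hxv, h⟩ := key ⟨l.localAction g v, hg v⟩ (hgen ▸ Subgroup.mem_top _)
  have hxv' : x⁻¹ v = v := by
    rw [← hxv]
    exact (x.symm_apply_apply v).trans hxv.symm
  have hgx : (x⁻¹ * g) v = v := by rw [RelIso.mul_apply, hv, hxv']
  let i : Fin d := Classical.arbitrary _
  have h1 : x⁻¹ * g ∈ plusGroup (l.universalGroup F) 1 := by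
    refine mem_plusGroup hT.2 (mul_mem (inv_mem (plusGroup_le hT.2 _ hx)) hg)
      (l.adj_nbr v i) hgx ?_
    rw [l.apply_nbr, hgx, l.localAction_mul, l.localAction_inv, hv, hxv', h]
    simp
  simpa using mul_mem hx h1

theorem LegalLabelling.exists_plusGroup_apply_eq (hT : T.IsTree)
    (htrans : MulAction.IsPretransitive F (Fin d))
    (hgen : (⨆ i : Fin d, MulAction.stabilizer F i) = ⊤) {v w w' : V} (hw : T.Adj v w)
    (hw' : T.Adj v w') : ∃ x ∈ plusGroup (l.universalGroup F) 1, x w = w' := by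
  obtain ⟨α, hα⟩ := MulAction.exists_smul_eq F (l.label.get v w hw) (l.label.get v w' hw')
  obtain ⟨x, hx, hxv, h⟩ := l.exists_mem_universalGroup hT α.2 v
  have : Nonempty (Fin d) := ⟨l.label.get v w hw⟩
  refine ⟨x, l.mem_plusGroup_of_fix hT hgen hx hxv, ?_⟩
  rw [← l.nbr_label hw, l.apply_nbr, hxv, h, ← l.nbr_label hw', ← hα]
  rfl

/-- If `F` is transitive and generated by its point stabilisers, then `U(F)^+` has index at most
two in `U(F)`. -/
theorem LegalLabelling.exists_mem_or_mul_inv_mem (hT : T.IsTree)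
    (htrans : MulAction.IsPretransitive F (Fin d))
    (hgen : (⨆ i : Fin d, MulAction.stabilizer F i) = ⊤) :
    ∃ k ∈ l.universalGroup F, ∀ g ∈ l.universalGroup F,
      g ∈ plusGroup (l.universalGroup F) 1 ∨ g * k⁻¹ ∈ plusGroup (l.universalGroup F) 1 := by
  by_cases hall : ∀ g ∈ l.universalGroup F, g ∈ plusGroup (l.universalGroup F) 1
  · exact ⟨1, one_mem _, fun g hg => Or.inl (hall g hg)⟩
  push Not at hall
  obtain ⟨k, hk, hk'⟩ := hall
  obtain ⟨a⟩ : Nonempty V := hT.1.nonempty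
  -- For d = 0 the tree is a single vertex.
  rcases isEmpty_or_nonempty (Fin d) with hd | ⟨⟨i⟩⟩
  · have : ∀ x, x = a := forall_of_adj hT.1.preconnected rfl fun x y hxy _ =>
      (hd.false (l.label.get x y hxy)).elim
    refine absurd (show k = 1 from RelIso.ext fun x => ?_) fun h => hk' (h ▸ one_mem _)
    rw [this x]
    exact this _
  have : Nonempty (Fin d) := ⟨i⟩
  -- U⁺ permutes the neighbours of each vertex transitively, so the two ends of one edge represent
  -- all its vertex orbits.
  have horbit : ∀ x, ∃ g ∈ plusGroup (l.universalGroup F) 1, g a = x ∨ g (l.nbr a i) = x := by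
    refine forall_of_adj hT.1.preconnected (a := a) ⟨1, one_mem _, Or.inl rfl⟩ ?_
    rintro x y hxy ⟨g, hg, hgx⟩
    rcases hgx with rfl | rfl
    · obtain ⟨z, hz, e⟩ := l.exists_plusGroup_apply_eq hT htrans hgen
        (g.map_adj_iff.2 (l.adj_nbr a i)) hxy
      exact ⟨z * g, mul_mem hz hg, Or.inr e⟩
    · obtain ⟨z, hz, e⟩ := l.exists_plusGroup_apply_eq hT htrans hgen
        (g.map_adj_iff.2 (l.adj_nbr a i).symm) hxy
      exact ⟨z * g, mul_mem hz hg, Or.inl e⟩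
  have hodd : ∀ g ∈ l.universalGroup F, g ∉ plusGroup (l.universalGroup F) 1 →
      ∃ u ∈ plusGroup (l.universalGroup F) 1, u (l.nbr a i) = g a := by
    intro g hg hg'
    obtain ⟨u, hu, h | h⟩ := horbit (g a)
    · refine absurd ?_ hg'
      have h1 : u⁻¹ * g ∈ plusGroup (l.universalGroup F) 1 := by
        refine l.mem_plusGroup_of_fix hT hgen (v := a)
          (mul_mem (inv_mem (plusGroup_le hT.2 _ hu)) hg) ?_
        change u.symm (g a) = a
        rw [← h]
        exact u.symm_apply_apply a
      simpa using mul_mem hu h1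
    · exact ⟨u, hu, h⟩
  refine ⟨k, hk, fun g hg => or_iff_not_imp_left.2 fun hg' => ?_⟩
  obtain ⟨u, hu, h⟩ := hodd g hg hg'
  obtain ⟨t, ht, h'⟩ := hodd k hk hk'
  -- This product fixes `l.nbr a i`: t sends it to k a, then k⁻¹ to a, g to g a, and u⁻¹ back.
  have h1 : u⁻¹ * (g * k⁻¹) * t ∈ plusGroup (l.universalGroup F) 1 := by
    refine l.mem_plusGroup_of_fix hT hgen (v := l.nbr a i) (mul_mem (mul_mem
      (inv_mem (plusGroup_le hT.2 _ hu)) (mul_mem hg (inv_mem hk))) (plusGroup_le hT.2 _ ht)) ?_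
    change u.symm (g (k.symm (t (l.nbr a i)))) = l.nbr a i
    rw [h', k.symm_apply_apply, ← h]
    exact u.symm_apply_apply _
  have h2 := mul_mem (mul_mem hu h1) (inv_mem ht)
  simpa [mul_assoc] using h2

theorem LegalLabelling.closedRange_universalGroup (hT : T.IsTree)
    (htrans : MulAction.IsPretransitive F (Fin d))
    (hgen : (⨆ i : Fin d, MulAction.stabilizer F i) = ⊤) :
    HasClosedRangeProperty.{w} (l.universalGroup F) := by
  intro H _ _ _ _ φ hφ
  have hle := plusGroup_le hT.2 (l.universalGroup F)
  let ι : plusGroup (l.universalGroup F) 1 →* l.universalGroup F := Subgroup.inclusion hle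
  have hι : Continuous ι := continuous_inclusion hle
  have hclosed : IsClosed (Set.range (φ.comp ι)) :=
    l.closedRange_plusGroup hT H (φ.comp ι) (hφ.comp hι)
  obtain ⟨k, hk, hcov⟩ := l.exists_mem_or_mul_inv_mem hT htrans hgen
  have hrange : Set.range φ =
      Set.range (φ.comp ι) ∪ (fun h => h * φ ⟨k, hk⟩) '' Set.range (φ.comp ι) := by
    refine Set.Subset.antisymm ?_ (Set.union_subset ?_ ?_)
    · rintro _ ⟨g, rfl⟩
      rcases hcov g g.2 with h | h
      · exact Or.inl ⟨⟨g, h⟩, rfl⟩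
      · refine Or.inr ⟨_, ⟨⟨_, h⟩, rfl⟩, ?_⟩
        change φ _ * φ _ = φ g
        rw [← map_mul]
        congr 1
        exact Subtype.ext (inv_mul_cancel_right _ _)
    · rintro _ ⟨g, rfl⟩
      exact ⟨ι g, rfl⟩
    · rintro _ ⟨_, ⟨g, rfl⟩, rfl⟩
      exact ⟨ι g * ⟨k, hk⟩, map_mul _ _ _⟩
  rw [hrange]
  exact hclosed.union ((Homeomorph.mulRight (φ ⟨k, hk⟩)).isClosedMap _ hclosed)

end ClosedRange

end TreeGroups

theorem mainTheorem4 {V : Type u} (T : SimpleGraph V) (d : ℕ)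
    (hT : T.IsTree) (hreg : ∀ v : V, (T.neighborSet v).encard = d)
    (l : TreeGroups.LegalLabelling T d) (F : Subgroup (Equiv.Perm (Fin d))) :
    TreeGroups.HasClosedRangeProperty.{w} (TreeGroups.plusGroup (l.universalGroup F) 1) ∧
    (MulAction.IsPretransitive F (Fin d) →
      (⨆ i : Fin d, MulAction.stabilizer F i) = ⊤ →
      TreeGroups.HasClosedRangeProperty.{w} (l.universalGroup F)) :=
  ⟨l.closedRange_plusGroup hT, l.closedRange_universalGroup hT⟩
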